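/- Let $n\ge 1$ and $r\ge 1$ be integers. For a Zariski-closed subgroup $G\subseteq \mathrm{GL}_r(\mathbb{C})$, let $$\mathfrak{R}_n(G)=\{(A,B)\in G^2 \;:\; A^nBA^{-n}B^{-1}=\mathrm{Id}\}$$ be the $G$-representation variety of the $n$-twisted Hopf link, a complex affine variety (with its reduced structure, closed in $G^2$) with coordinate ring $\mathbb{C}[\mathfrak{R}_n(G)]$, and let $$\mathfrak{M}_n(G)=\mathfrak{R}_n(G)/\!\!/G=\operatorname{Spec}\big(\mathbb{C}[\mathfrak{R}_n(G)]^{G}\big)$$ be the $G$-character variety, where $G$ acts by simultaneous conjugation, $g\cdot(A,B)=(g^{-1}Ag,\,g^{-1}Bg)$. Let $\mu_r=\{\zeta\in\mathbb{C}:\zeta^r=1\}$. For an affine variety $X$ with an action of the finite group $\mu_r^2=\mu_r\times\mu_r$, write $X/\mu_r^2=\operatorname{Spec}(\mathbb{C}[X]^{\mu_r^2})$. Then there are isomorphisms of complex affine varieties (that is, over $\mathbb{C}$) $$\mathfrak{R}_n(\mathrm{GL}_r)\cong\big(\mathfrak{R}_n(\mathrm{SL}_r)\times(\mathbb{C}^*)^2\big)/\mu_r^2,\qquad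 \mathfrak{M}_n(\mathrm{GL}_r)\cong\big(\mathfrak{M}_n(\mathrm{SL}_r)\times(\mathbb{C}^*)^2\big)/\mu_r^2,$$ where $\mu_r^2$ acts by componentwise multiplication: $(\zeta_1,\zeta_2)$ acts on $\mathfrak{R}_n(\mathrm{SL}_r)\times(\mathbb{C}^*)^2$ by $$\big((A,B),(\lambda_1,\lambda_2)\big)\mapsto\big((\zeta_1A,\zeta_2B),(\zeta_1\lambda_1,\zeta_2\lambda_2)\big),$$ and on $\mathfrak{M}_n(\mathrm{SL}_r)\times(\mathbb{C}^*)^2$ by the induced action on $\mathfrak{M}_n(\mathrm{SL}_r)$ (the actions by scaling and conjugation commute) together with the same action on $(\mathbb{C}^*)^2$. -/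

import Mathlib

open AlgebraicGeometry CategoryTheory
open scoped TensorProduct

noncomputable section

namespace TwistedHopf

/-! ### Coordinate rings of affine varieties -/

/-- The algebra of regular functions on an affine variety whose set of points is `X`, embedded in
an affine space by the coordinate functions `x i`: the functions on `X` that are polynomials in
the coordinates. -/
def regularFunctions {X ι : Type} (x : ι → X → ℂ) : Subalgebra ℂ (X → ℂ) :=
  Algebra.adjoin ℂ (Set.range x)

/-- Composition of functions with a map of sets, as a homomorphism of algebras. -/
def pullback {X Y : Type} (φ : X → Y) : (Y → ℂ) →ₐ[ℂ] (X → ℂ) :=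
  AlgHom.pi fun p => Pi.evalAlgHom ℂ (fun _ : Y => ℂ) (φ p)

@[simp]
theorem pullback_apply {X Y : Type} (φ : X → Y) (f : Y → ℂ) (p : X) :
    pullback φ f p = f (φ p) := rfl

theorem pullback_mem {X Y ι κ : Type} {x : ι → X → ℂ} {y : κ → Y → ℂ} {φ : X → Y}
    (h : ∀ k, y k ∘ φ ∈ regularFunctions x) {f : Y → ℂ} (hf : f ∈ regularFunctions y) :
    pullback φ f ∈ regularFunctions x := by
  have hle : regularFunctions y ≤ (regularFunctions x).comap (pullback φ) := by
    refine Algebra.adjoin_le ?_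
    rintro _ ⟨k, rfl⟩
    exact h k
  exact hle hf

/-- The comorphism `f ↦ f ∘ φ` of a morphism `φ : X → Y` of affine varieties. -/
def comorphism {X Y ι κ : Type} {x : ι → X → ℂ} {y : κ → Y → ℂ} (φ : X → Y)
    (h : ∀ k, y k ∘ φ ∈ regularFunctions x) :
    regularFunctions y →ₐ[ℂ] regularFunctions x :=
  ((pullback φ).comp (regularFunctions y).val).codRestrict (regularFunctions x)
    fun f => pullback_mem h f.2

/-- The complex affine scheme `Spec S`, as a scheme over `Spec ℂ`. -/
def affineScheme (S : Type) [CommRing S] [Algebra ℂ S] : Over (Spec (CommRingCat.of ℂ)) :=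
  Over.mk (Spec.map (CommRingCat.ofHom (algebraMap ℂ S)))

/-- The subalgebra of elements fixed by every member of a family of endomorphisms. When the
family consists of the comorphisms of the elements of a group acting on `Spec S`, this is the
algebra of invariants. -/
def invariants {S F : Type} [CommRing S] [Algebra ℂ S] (a : F → S →ₐ[ℂ] S) : Subalgebra ℂ S where
  carrier := {s | ∀ g, a g s = s}
  mul_mem' hs ht g := by rw [map_mul, hs g, ht g]
  add_mem' hs ht g := by rw [map_add, hs g, ht g]
  algebraMap_mem' c g := (a g).commutes c

/-! ### Representation and character varieties -/

/-- The special linear group `SL_r`, as a subgroup of `GL_r`. -/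
def SLr (r : ℕ) : Subgroup (GL (Fin r) ℂ) :=
  (Matrix.GeneralLinearGroup.det (n := Fin r) (R := ℂ)).ker

/-- The points of the `G`-representation variety of the `n`-twisted Hopf link: pairs `(A, B)` of
elements of `G` with `[A ^ n, B] = Aⁿ B A⁻ⁿ B⁻¹ = 1`. -/
def Rep (n : ℕ) {r : ℕ} (G : Subgroup (GL (Fin r) ℂ)) : Type :=
  {p : G × G // p.1 ^ n * p.2 * (p.1 ^ n)⁻¹ * p.2⁻¹ = 1}

theorem commutator_eq_one_iff {G : Type} [Group G] (a b : G) :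
    a * b * a⁻¹ * b⁻¹ = 1 ↔ Commute a b := by
  rw [mul_inv_eq_one, mul_inv_eq_iff_eq_mul]
  rfl

/-- The coordinates on `GL_r`: the matrix entries, and the inverse of the determinant. -/
def coordGL {r : ℕ} (A : GL (Fin r) ℂ) : Option (Fin r × Fin r) → ℂ
  | some (j, k) => (A : Matrix (Fin r) (Fin r) ℂ) j k
  | none => ((A : Matrix (Fin r) (Fin r) ℂ).det)⁻¹

/-- The coordinates of a pair `(A, B)`: those of `A` and those of `B`. -/
def coordRep (n : ℕ) {r : ℕ} (G : Subgroup (GL (Fin r) ℂ)) :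
    Option (Fin r × Fin r) ⊕ Option (Fin r × Fin r) → Rep n G → ℂ
  | Sum.inl i => fun p => coordGL (p.1.1 : GL (Fin r) ℂ) i
  | Sum.inr i => fun p => coordGL (p.1.2 : GL (Fin r) ℂ) i

/-- The coordinate ring of the `G`-representation variety. -/
abbrev RepRing (n : ℕ) {r : ℕ} (G : Subgroup (GL (Fin r) ℂ)) : Subalgebra ℂ (Rep n G → ℂ) :=
  regularFunctions (coordRep n G)

/-- The action of `g` in `G` on representations by conjugation,
`(A, B) ↦ (g⁻¹ A g, g⁻¹ B g)`. -/
def conj {n r : ℕ} {G : Subgroup (GL (Fin r) ℂ)} (g : G) (p : Rep n G) : Rep n G :=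
  ⟨(g⁻¹ * p.1.1 * g, g⁻¹ * p.1.2 * g), by
    have h : Commute (p.1.1 ^ n) p.1.2 := (commutator_eq_one_iff _ _).1 p.2
    have h1 : (g⁻¹ * p.1.1 * g) ^ n = g⁻¹ * p.1.1 ^ n * g := by
      simpa using conj_pow (a := g⁻¹) (b := p.1.1) (i := n)
    refine (commutator_eq_one_iff _ _).2 ?_
    rw [h1]
    calc g⁻¹ * p.1.1 ^ n * g * (g⁻¹ * p.1.2 * g) = g⁻¹ * (p.1.1 ^ n * p.1.2) * g := by group
      _ = g⁻¹ * (p.1.2 * p.1.1 ^ n) * g := by rw [h.eq]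
      _ = g⁻¹ * p.1.2 * g * (g⁻¹ * p.1.1 ^ n * g) := by group⟩

/-- The coordinate ring of the `G`-character variety: the regular functions on the
representation variety that are invariant under conjugation by `G`. -/
def CharRing (n : ℕ) {r : ℕ} (G : Subgroup (GL (Fin r) ℂ)) : Subalgebra ℂ (RepRing n G) where
  carrier := {f | ∀ (g : G) (p : Rep n G), f.1 (conj g p) = f.1 p}
  mul_mem' hf hf' g p := congrArg₂ (· * ·) (hf g p) (hf' g p)
  add_mem' hf hf' g p := congrArg₂ (· + ·) (hf g p) (hf' g p)
  algebraMap_mem' _ _ _ := rfl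

/-- The `G`-representation variety of the `n`-twisted Hopf link. -/
def repVariety (n : ℕ) {r : ℕ} (G : Subgroup (GL (Fin r) ℂ)) : Over (Spec (CommRingCat.of ℂ)) :=
  affineScheme (RepRing n G)

/-- The `G`-character variety of the `n`-twisted Hopf link: the GIT quotient of the
representation variety by conjugation. -/
def charVariety (n : ℕ) {r : ℕ} (G : Subgroup (GL (Fin r) ℂ)) : Over (Spec (CommRingCat.of ℂ)) :=
  affineScheme (CharRing n G)

/-! ### The torus `(ℂ*)²` and the actions of `μ_r × μ_r` -/

/-- The group `μ_r × μ_r`. -/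
abbrev Mu2 (r : ℕ) : Type := rootsOfUnity r ℂ × rootsOfUnity r ℂ

/-- The coordinates `z₁, z₁⁻¹, z₂, z₂⁻¹` on `(ℂ*)²`. -/
def coordTorus : Bool ⊕ Bool → ℂˣ × ℂˣ → ℂ
  | Sum.inl false => fun z => (z.1 : ℂ)
  | Sum.inl true => fun z => ((z.1⁻¹ : ℂˣ) : ℂ)
  | Sum.inr false => fun z => (z.2 : ℂ)
  | Sum.inr true => fun z => ((z.2⁻¹ : ℂˣ) : ℂ)

/-- The coordinate ring of `(ℂ*)²`. -/
abbrev TorusRing : Subalgebra ℂ (ℂˣ × ℂˣ → ℂ) := regularFunctions coordTorus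

/-- The action of `(ζ₁, ζ₂)` on `(ℂ*)²`: `(z₁, z₂) ↦ (ζ₁ z₁, ζ₂ z₂)`. -/
def scaleTorus {r : ℕ} (ζ : Mu2 r) (z : ℂˣ × ℂˣ) : ℂˣ × ℂˣ := ((ζ.1 : ℂˣ) * z.1, (ζ.2 : ℂˣ) * z.2)

/-- The comorphism of the action of `(ζ₁, ζ₂)` on `(ℂ*)²`. -/
def torusAct {r : ℕ} (ζ : Mu2 r) : TorusRing →ₐ[ℂ] TorusRing :=
  comorphism (scaleTorus ζ) (by
    have key : ∀ (c : ℂ) (k : Bool ⊕ Bool), (fun z => c * coordTorus k z) ∈ TorusRing :=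
      fun c k => Subalgebra.smul_mem _ (Algebra.subset_adjoin (Set.mem_range_self k)) c
    rintro ((_ | _) | (_ | _))
    · exact key ((ζ.1 : ℂˣ) : ℂ) (Sum.inl false)
    · convert key (((ζ.1 : ℂˣ)⁻¹ : ℂˣ) : ℂ) (Sum.inl true) using 2 with z
      simp [coordTorus, scaleTorus, mul_comm]
    · exact key ((ζ.2 : ℂˣ) : ℂ) (Sum.inr false)
    · convert key (((ζ.2 : ℂˣ)⁻¹ : ℂˣ) : ℂ) (Sum.inr true) using 2 with z
      simp [coordTorus, scaleTorus, mul_comm])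

/-- The scalar matrix of an `r`-th root of unity, an element of `SL_r`. -/
def scalarSL {r : ℕ} (ζ : rootsOfUnity r ℂ) : SLr r :=
  ⟨Matrix.GeneralLinearGroup.scalar (Fin r) (ζ : ℂˣ), by
    have h := (mem_rootsOfUnity r (ζ : ℂˣ)).1 ζ.2
    rw [SLr, MonoidHom.mem_ker, Matrix.GeneralLinearGroup.det_scalar, Fintype.card_fin, h]⟩

theorem scalarSL_comm {r : ℕ} (ζ : rootsOfUnity r ℂ) (A : SLr r) :
    scalarSL ζ * A = A * scalarSL ζ :=
  Subtype.ext (Matrix.GeneralLinearGroup.scalar_commute (ζ : ℂˣ) (A : GL (Fin r) ℂ))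

/-- The action of `(ζ₁, ζ₂)` on pairs of matrices: `(A, B) ↦ (ζ₁ A, ζ₂ B)`. -/
def scaleRep {n r : ℕ} (ζ : Mu2 r) (p : Rep n (SLr r)) : Rep n (SLr r) :=
  ⟨(scalarSL ζ.1 * p.1.1, scalarSL ζ.2 * p.1.2), by
    have hA : ∀ X, Commute (scalarSL ζ.1) X := fun X => scalarSL_comm ζ.1 X
    have hB : ∀ X, Commute (scalarSL ζ.2) X := fun X => scalarSL_comm ζ.2 X
    have h : Commute (p.1.1 ^ n) p.1.2 := (commutator_eq_one_iff _ _).1 p.2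
    refine (commutator_eq_one_iff _ _).2 ?_
    rw [(hA p.1.1).mul_pow]
    exact (((hA _).pow_left n).mul_left ((hB _).symm.mul_right h))⟩

/-- The comorphism of the action of `(ζ₁, ζ₂)` on the `SL_r`-representation variety. -/
def repAct (n : ℕ) {r : ℕ} (ζ : Mu2 r) : RepRing n (SLr r) →ₐ[ℂ] RepRing n (SLr r) :=
  comorphism (scaleRep ζ) (by
    have key : ∀ (c : ℂ) k, (fun p => c * coordRep n (SLr r) k p) ∈ RepRing n (SLr r) :=
      fun c k => Subalgebra.smul_mem _ (Algebra.subset_adjoin (Set.mem_range_self k)) c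
    have hc : ∀ (η : rootsOfUnity r ℂ) (i : Option (Fin r × Fin r)), ∃ c : ℂ, ∀ A : SLr r,
        coordGL ((scalarSL η * A : SLr r) : GL (Fin r) ℂ) i = c * coordGL (A : GL (Fin r) ℂ) i := by
      rintro η (_ | ⟨j, k⟩)
      · refine ⟨(((η : ℂˣ) : ℂ) ^ r)⁻¹, fun A => ?_⟩
        simp [coordGL, scalarSL, mul_comm]
      · refine ⟨((η : ℂˣ) : ℂ), fun A => ?_⟩
        simp [coordGL, scalarSL]
    rintro (i | i)
    · obtain ⟨c, h⟩ := hc ζ.1 i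
      convert key c (Sum.inl i) using 2 with p
      exact h p.1.1
    · obtain ⟨c, h⟩ := hc ζ.2 i
      convert key c (Sum.inr i) using 2 with p
      exact h p.1.2)

theorem scaleRep_conj {n r : ℕ} (ζ : Mu2 r) (g : SLr r) (p : Rep n (SLr r)) :
    scaleRep ζ (conj g p) = conj g (scaleRep ζ p) := by
  have h : ∀ (η : rootsOfUnity r ℂ) (A : SLr r),
      scalarSL η * (g⁻¹ * A * g) = g⁻¹ * (scalarSL η * A) * g := fun η A => by
    rw [← mul_assoc, ← mul_assoc, ← mul_assoc, scalarSL_comm η g⁻¹]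
  exact Subtype.ext (Prod.ext (h _ _) (h _ _))

/-- The comorphism of the action of `(ζ₁, ζ₂)` on the `SL_r`-character variety, induced by the
action on the representation variety. -/
def charAct (n : ℕ) {r : ℕ} (ζ : Mu2 r) : CharRing n (SLr r) →ₐ[ℂ] CharRing n (SLr r) :=
  ((repAct n ζ).comp (CharRing n (SLr r)).val).codRestrict (CharRing n (SLr r)) (by
    intro f g p
    change f.1.1 (scaleRep ζ (conj g p)) = f.1.1 (scaleRep ζ p)
    rw [scaleRep_conj]
    exact f.2 g _)

/-! ### The quotients by `μ_r × μ_r` -/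

/-- `(Spec S × (ℂ*)²) / (μ_r × μ_r)`, where `(ζ₁, ζ₂)` acts on `Spec S` through the comorphism
`a (ζ₁, ζ₂)` and on `(ℂ*)²` by componentwise multiplication: the spectrum of the invariants in
the coordinate ring `S ⊗ ℂ[(ℂ*)²]` of the product. -/
def quotientByMu2 {r : ℕ} (S : Type) [CommRing S] [Algebra ℂ S] (a : Mu2 r → S →ₐ[ℂ] S) :
    Over (Spec (CommRingCat.of ℂ)) :=
  affineScheme
    (invariants fun ζ : Mu2 r => Algebra.TensorProduct.map (a ζ) (torusAct ζ) :
      Subalgebra ℂ (S ⊗[ℂ] TorusRing))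

end TwistedHopf

end

noncomputable section

namespace TwistedHopf

/-! ### Isomorphisms of affine schemes and invariants -/

theorem nonempty_affineScheme_iso {S R : Type} [CommRing S] [Algebra ℂ S] [CommRing R]
    [Algebra ℂ R] (e : S ≃ₐ[ℂ] R) : Nonempty (affineScheme S ≅ affineScheme R) := by
  refine ⟨Over.isoMk (Scheme.Spec.mapIso e.symm.toRingEquiv.toCommRingCatIso.op) ?_⟩
  change Spec.map _ ≫ Spec.map _ = Spec.map _
  rw [← Spec.map_comp]
  congr 1
  ext c
  exact e.symm.commutes c

theorem nonempty_algEquiv_of_map_eq {A B C : Type} [CommRing A] [Algebra ℂ A] [CommRing B]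
    [Algebra ℂ B] [CommRing C] [Algebra ℂ C] {U : Subalgebra ℂ A} {V : Subalgebra ℂ B}
    {f : A →ₐ[ℂ] C} {g : B →ₐ[ℂ] C} (hf : Function.Injective f) (hg : Function.Injective g)
    (h : U.map f = V.map g) : Nonempty (U ≃ₐ[ℂ] V) :=
  ⟨(U.equivMapOfInjective f hf).trans
    ((Subalgebra.equivOfEq _ _ h).trans (V.equivMapOfInjective g hg).symm)⟩

/-! ### Tensor products of algebras of functions -/

section ExternalProduct

variable {X T S Q : Type} [CommRing S] [Algebra ℂ S] [CommRing Q] [Algebra ℂ Q]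

/-- The homomorphism sending `s ⊗ q` to the function `(x, t) ↦ s(x) q(t)`, for algebras `S` and
`Q` that map to algebras of functions. -/
def externalProduct (i : S →ₐ[ℂ] (X → ℂ)) (j : Q →ₐ[ℂ] (T → ℂ)) : S ⊗[ℂ] Q →ₐ[ℂ] (X × T → ℂ) :=
  Algebra.TensorProduct.productMap ((pullback Prod.fst).comp i) ((pullback Prod.snd).comp j)

variable {i : S →ₐ[ℂ] (X → ℂ)} {j : Q →ₐ[ℂ] (T → ℂ)}

@[simp]
theorem externalProduct_tmul (s : S) (q : Q) (p : X × T) :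
    externalProduct i j (s ⊗ₜ q) p = i s p.1 * j q p.2 := rfl

theorem eq_of_sum_basis_eq {κ : Type} (b : Module.Basis κ ℂ Q) (hj : Function.Injective j)
    {c d : κ →₀ S} {x y : X}
    (h : ∀ t, externalProduct i j (c.sum fun k s => s ⊗ₜ b k) (x, t) =
      externalProduct i j (d.sum fun k s => s ⊗ₜ b k) (y, t)) (k : κ) :
    i (c k) x = i (d k) y := by
  have key : ∀ (c : κ →₀ S) (x : X) (t : T),
      externalProduct i j (c.sum fun k s => s ⊗ₜ b k) (x, t) =
        j (Finsupp.linearCombination ℂ b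
          (c.mapRange (fun s => i s x) (by simp))) t := by
    intro c x t
    rw [Finsupp.linearCombination_apply, Finsupp.sum_mapRange_index (by simp), Finsupp.sum,
      Finsupp.sum, map_sum, map_sum, Finset.sum_apply, Finset.sum_apply]
    refine Finset.sum_congr rfl fun k _ => ?_
    simp
  have h' := b.linearIndependent (hj (funext fun t =>
    ((key c x t).symm.trans (h t)).trans (key d y t)))
  exact DFunLike.congr_fun h' k

theorem externalProduct_injective (hi : Function.Injective i) (hj : Function.Injective j) :
    Function.Injective (externalProduct i j) := by
  let b := Module.Basis.ofVectorSpace ℂ Q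
  intro s t hst
  obtain ⟨c, rfl⟩ := TensorProduct.eq_repr_basis_right b s
  obtain ⟨d, rfl⟩ := TensorProduct.eq_repr_basis_right b t
  have : c = d := Finsupp.ext fun k => hi <| funext fun x =>
    eq_of_sum_basis_eq b hj (fun t => congrFun hst (x, t)) k
  rw [this]

theorem externalProduct_map {φ : S →ₐ[ℂ] S} {ψ : Q →ₐ[ℂ] Q} {a : X → X} {m : T → T}
    (hφ : ∀ s x, i (φ s) x = i s (a x)) (hψ : ∀ q t, j (ψ q) t = j q (m t)) (s : S ⊗[ℂ] Q)
    (p : X × T) :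
    externalProduct i j (Algebra.TensorProduct.map φ ψ s) p =
      externalProduct i j s (a p.1, m p.2) := by
  induction s with
  | zero => simp
  | tmul s q => simp [hφ, hψ]
  | add s t hs ht => simp only [map_add, Pi.add_apply, hs, ht]

/-- The functions on a set that are fixed by a family of self-maps. -/
def fixedFunctions {Z F : Type} (a : F → Z → Z) : Subalgebra ℂ (Z → ℂ) :=
  invariants fun g => pullback (a g)

theorem mem_fixedFunctions {Z F : Type} {a : F → Z → Z} {f : Z → ℂ} :
    f ∈ fixedFunctions a ↔ ∀ g z, f (a g z) = f z :=
  forall_congr' fun _ => funext_iff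

theorem map_externalProduct_invariants {F : Type} (hi : Function.Injective i)
    (hj : Function.Injective j) {φ : F → S →ₐ[ℂ] S} {ψ : F → Q →ₐ[ℂ] Q} {a : F → X → X}
    {m : F → T → T} (hφ : ∀ g s x, i (φ g s) x = i s (a g x))
    (hψ : ∀ g q t, j (ψ g q) t = j q (m g t)) :
    (invariants fun g => Algebra.TensorProduct.map (φ g) (ψ g)).map (externalProduct i j) =
      (externalProduct i j).range ⊓ fixedFunctions fun g p => (a g p.1, m g p.2) := by
  ext f
  constructor
  · rintro ⟨s, hs, rfl⟩
    refine ⟨⟨s, rfl⟩, mem_fixedFunctions.2 fun g p => ?_⟩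
    exact (externalProduct_map (hφ g) (hψ g) s p).symm.trans (by rw [hs g]; rfl)
  · rintro ⟨⟨s, rfl⟩, hs⟩
    refine ⟨s, fun g => externalProduct_injective hi hj (funext fun p => ?_), rfl⟩
    rw [externalProduct_map (hφ g) (hψ g)]
    exact mem_fixedFunctions.1 hs g p

/-- If `S'` consists of the elements of `S` that are fixed by a family of self-maps of `X`, then
`S' ⊗ Q` consists of the elements of `S ⊗ Q` that are fixed by it. -/
theorem range_externalProduct_comp_val {F : Type} (S' : Subalgebra ℂ S)
    (hj : Function.Injective j) {a : F → X → X}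
    (hS : ∀ s, s ∈ S' ↔ ∀ g x, i s (a g x) = i s x) :
    (externalProduct (i.comp S'.val) j).range =
      (externalProduct i j).range ⊓ fixedFunctions fun g p => (a g p.1, p.2) := by
  let b := Module.Basis.ofVectorSpace ℂ Q
  apply le_antisymm
  · rintro _ ⟨s, rfl⟩
    induction s with
    | zero => simp
    | tmul s q =>
      refine ⟨⟨s.1 ⊗ₜ q, rfl⟩, mem_fixedFunctions.2 fun g p => ?_⟩
      exact congrArg (· * j q p.2) ((hS s.1).1 s.2 g p.1)
    | add s t hs ht => rw [RingHom.map_add]; exact add_mem hs ht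
  · rintro _ ⟨⟨s, rfl⟩, hs⟩
    obtain ⟨c, rfl⟩ := TensorProduct.eq_repr_basis_right b s
    have hc : ∀ k, c k ∈ S' := fun k => (hS _).2 fun g x =>
      eq_of_sum_basis_eq b hj (fun t => mem_fixedFunctions.1 hs g (x, t)) k
    change externalProduct i j _ ∈ _
    rw [Finsupp.sum, map_sum]
    exact sum_mem fun k _ => ⟨(⟨c k, hc k⟩ : S') ⊗ₜ b k, rfl⟩

end ExternalProduct

/-! ### The morphism `((A, B), (z₁, z₂)) ↦ (z₁⁻¹ A, z₂⁻¹ B)` -/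

open Matrix.GeneralLinearGroup (scalar)

variable {n r : ℕ}

theorem scalar_commute' (z : ℂˣ) (A : GL (Fin r) ℂ) : Commute (scalar (Fin r) z) A :=
  Matrix.GeneralLinearGroup.scalar_commute z A

theorem commute_scalar_mul_pow {A B : GL (Fin r) ℂ} (h : Commute (A ^ n) B) (z w : ℂˣ) :
    Commute ((scalar (Fin r) z * A) ^ n) (scalar (Fin r) w * B) := by
  rw [(scalar_commute' z A).mul_pow]
  exact ((scalar_commute' z _).pow_left n).mul_left ((scalar_commute' w _).symm.mul_right h)

theorem Rep.commute {G : Subgroup (GL (Fin r) ℂ)} (p : Rep n G) :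
    Commute ((p.1.1 : GL (Fin r) ℂ) ^ n) (p.1.2 : GL (Fin r) ℂ) :=
  ((commutator_eq_one_iff _ _).1 p.2).map G.subtype

/-- The representation given by two matrices. -/
def Rep.mk {G : Subgroup (GL (Fin r) ℂ)} (A B : G)
    (h : Commute ((A : GL (Fin r) ℂ) ^ n) (B : GL (Fin r) ℂ)) : Rep n G :=
  ⟨(A, B), (commutator_eq_one_iff _ _).2 (Subtype.ext h)⟩

theorem Rep.ext {G : Subgroup (GL (Fin r) ℂ)} {p q : Rep n G}
    (h₁ : (p.1.1 : GL (Fin r) ℂ) = q.1.1) (h₂ : (p.1.2 : GL (Fin r) ℂ) = q.1.2) : p = q :=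
  Subtype.ext (Prod.ext (Subtype.ext h₁) (Subtype.ext h₂))

/-- The morphism `((A, B), (z₁, z₂)) ↦ (z₁⁻¹ A, z₂⁻¹ B)`. -/
def unscale (p : Rep n (SLr r) × (ℂˣ × ℂˣ)) : Rep n (⊤ : Subgroup (GL (Fin r) ℂ)) :=
  Rep.mk ⟨scalar (Fin r) p.2.1⁻¹ * p.1.1.1, trivial⟩ ⟨scalar (Fin r) p.2.2⁻¹ * p.1.1.2, trivial⟩
    (commute_scalar_mul_pow p.1.commute _ _)

theorem exists_scalar_mul_mem_SLr (hr : 1 ≤ r) (A : GL (Fin r) ℂ) :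
    ∃ z : ℂˣ, scalar (Fin r) z * A ∈ SLr r := by
  obtain ⟨z, hz⟩ := IsAlgClosed.exists_pow_nat_eq ((A.det⁻¹ : ℂˣ) : ℂ) hr
  have hz0 : z ≠ 0 := by
    rintro rfl
    rw [zero_pow (by lia)] at hz
    exact (A.det⁻¹).ne_zero hz.symm
  refine ⟨Units.mk0 z hz0, ?_⟩
  have : Units.mk0 z hz0 ^ r = A.det⁻¹ := Units.ext hz
  rw [SLr, MonoidHom.mem_ker, map_mul, Matrix.GeneralLinearGroup.det_scalar, Fintype.card_fin,
    this, inv_mul_cancel]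

theorem scalar_inv_mul_scalar_mul (z : ℂˣ) (A : GL (Fin r) ℂ) :
    scalar (Fin r) z⁻¹ * (scalar (Fin r) z * A) = A := by
  rw [← mul_assoc, ← map_mul, inv_mul_cancel, map_one, one_mul]

theorem unscale_surjective (hr : 1 ≤ r) : Function.Surjective (unscale (n := n) (r := r)) := by
  intro q
  obtain ⟨z, hz⟩ := exists_scalar_mul_mem_SLr hr q.1.1
  obtain ⟨w, hw⟩ := exists_scalar_mul_mem_SLr hr q.1.2
  exact ⟨(Rep.mk ⟨_, hz⟩ ⟨_, hw⟩ (commute_scalar_mul_pow q.commute _ _), (z, w)),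
    Rep.ext (scalar_inv_mul_scalar_mul _ _) (scalar_inv_mul_scalar_mul _ _)⟩

theorem unscale_scale (ζ : Mu2 r) (p : Rep n (SLr r) × (ℂˣ × ℂˣ)) :
    unscale (scaleRep ζ p.1, scaleTorus ζ p.2) = unscale p := by
  have h : ∀ (a z : ℂˣ) (A : GL (Fin r) ℂ),
      scalar (Fin r) (a * z)⁻¹ * (scalar (Fin r) a * A) = scalar (Fin r) z⁻¹ * A := fun a z A => by
    rw [← mul_assoc, ← map_mul, mul_inv_rev, mul_assoc, inv_mul_cancel, mul_one]
  exact Rep.ext (h _ _ _) (h _ _ _)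

theorem unscale_conj (g : SLr r) (p : Rep n (SLr r)) (z : ℂˣ × ℂˣ) :
    unscale (conj g p, z) = conj ⟨g, Subgroup.mem_top _⟩ (unscale (p, z)) := by
  have h : ∀ (z : ℂˣ) (g A : GL (Fin r) ℂ),
      scalar (Fin r) z * (g⁻¹ * A * g) = g⁻¹ * (scalar (Fin r) z * A) * g := fun z g A => by
    rw [← mul_assoc, ← mul_assoc, ← mul_assoc, (scalar_commute' z g⁻¹).eq]
  exact Rep.ext (h _ _ _) (h _ _ _)

theorem exists_conj_eq_conj_SLr (hr : 1 ≤ r) (g : (⊤ : Subgroup (GL (Fin r) ℂ))) :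
    ∃ g' : SLr r, ∀ p : Rep n (⊤ : Subgroup (GL (Fin r) ℂ)),
      conj g p = conj ⟨(g' : GL (Fin r) ℂ), Subgroup.mem_top _⟩ p := by
  obtain ⟨z, hz⟩ := exists_scalar_mul_mem_SLr hr g.1
  have h : ∀ A : GL (Fin r) ℂ, g.1⁻¹ * A * g.1 =
      (scalar (Fin r) z * g.1)⁻¹ * A * (scalar (Fin r) z * g.1) := fun A => by
    rw [mul_inv_rev, mul_assoc (g.1⁻¹), mul_assoc (g.1⁻¹), mul_assoc (g.1⁻¹), mul_assoc (_⁻¹),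
      ← mul_assoc A, ← (scalar_commute' z A).eq, mul_assoc, inv_mul_cancel_left]
  exact ⟨⟨_, hz⟩, fun p => Rep.ext (h _) (h _)⟩

/-! ### Regular functions on the product with the torus -/

/-- The embedding of `ℂ[R_n(SL_r)] ⊗ ℂ[(ℂ*)²]` in the algebra of functions on the product. -/
abbrev prodEmbedding (n r : ℕ) :
    RepRing n (SLr r) ⊗[ℂ] TorusRing →ₐ[ℂ] (Rep n (SLr r) × (ℂˣ × ℂˣ) → ℂ) :=
  externalProduct (RepRing n (SLr r)).val TorusRing.val

theorem mul_mem_range_prodEmbedding {f : Rep n (SLr r) → ℂ} {h : ℂˣ × ℂˣ → ℂ}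
    (hf : f ∈ RepRing n (SLr r)) (hh : h ∈ TorusRing) :
    (fun p => f p.1 * h p.2) ∈ (prodEmbedding n r).range :=
  ⟨(⟨f, hf⟩ : RepRing n (SLr r)) ⊗ₜ (⟨h, hh⟩ : TorusRing), rfl⟩

theorem coordRep_mem {G : Subgroup (GL (Fin r) ℂ)} (k) : coordRep n G k ∈ RepRing n G :=
  Algebra.subset_adjoin (Set.mem_range_self k)

theorem coordTorus_mem (k) : coordTorus k ∈ TorusRing :=
  Algebra.subset_adjoin (Set.mem_range_self k)

theorem det_SLr (A : SLr r) : ((A : GL (Fin r) ℂ) : Matrix (Fin r) (Fin r) ℂ).det = 1 :=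
  congrArg Units.val (MonoidHom.mem_ker.1 A.2)

theorem coordGL_scalar_mul (z : ℂˣ) (A : GL (Fin r) ℂ) (j k : Fin r) :
    coordGL (scalar (Fin r) z * A) (some (j, k)) = z * coordGL A (some (j, k)) := by
  simp [coordGL]

theorem coordGL_scalar_mul_none (z : ℂˣ) (A : SLr r) :
    coordGL (scalar (Fin r) z * (A : GL (Fin r) ℂ)) none = ((z⁻¹ : ℂˣ) : ℂ) ^ r := by
  simp [coordGL, det_SLr]

theorem det_mem_RepRing {G : Subgroup (GL (Fin r) ℂ)} (s : G × G → G)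
    (hs : ∀ j k, (fun p : Rep n G => ((s p.1 : GL (Fin r) ℂ) : Matrix (Fin r) (Fin r) ℂ) j k) ∈ RepRing n G) :
    (fun p : Rep n G => ((s p.1 : GL (Fin r) ℂ) : Matrix (Fin r) (Fin r) ℂ).det) ∈ RepRing n G := by
  have : (fun p : Rep n G => ((s p.1 : GL (Fin r) ℂ) : Matrix (Fin r) (Fin r) ℂ).det) =
      ∑ σ : Equiv.Perm (Fin r), ((Equiv.Perm.sign σ : ℤ) : ℂ) •
        ∏ i, fun p : Rep n G => ((s p.1 : GL (Fin r) ℂ) : Matrix (Fin r) (Fin r) ℂ) (σ i) i := by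
    funext p
    simp [Matrix.det_apply', Finset.sum_apply, Finset.prod_apply]
  rw [this]
  exact sum_mem fun σ _ => Subalgebra.smul_mem _ (prod_mem fun i _ => hs _ _) _

variable (n r) in
/-- The functions on the product that are pulled back from regular functions on `R_n(GL_r)`. -/
def descended : Subalgebra ℂ (Rep n (SLr r) × (ℂˣ × ℂˣ) → ℂ) :=
  (RepRing n (⊤ : Subgroup (GL (Fin r) ℂ))).map (pullback unscale)

theorem descended_le_range : descended n r ≤ (prodEmbedding n r).range := by
  rw [descended, RepRing, regularFunctions, AlgHom.map_adjoin]
  refine Algebra.adjoin_le ?_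
  rintro _ ⟨_, ⟨(_ | ⟨j, k⟩) | (_ | ⟨j, k⟩), rfl⟩, rfl⟩
  · change _ ∈ (prodEmbedding n r).range
    convert mul_mem_range_prodEmbedding (one_mem (RepRing n (SLr r)))
      (pow_mem (coordTorus_mem (Sum.inl false)) r) using 1
    funext p
    exact (coordGL_scalar_mul_none _ _).trans (by simp [coordTorus])
  · change _ ∈ (prodEmbedding n r).range
    convert mul_mem_range_prodEmbedding (coordRep_mem (n := n) (G := SLr r)
      (Sum.inl (some (j, k)))) (coordTorus_mem (Sum.inl true)) using 1
    funext p
    exact (coordGL_scalar_mul _ _ _ _).trans (mul_comm _ _)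
  · change _ ∈ (prodEmbedding n r).range
    convert mul_mem_range_prodEmbedding (one_mem (RepRing n (SLr r)))
      (pow_mem (coordTorus_mem (Sum.inr false)) r) using 1
    funext p
    exact (coordGL_scalar_mul_none _ _).trans (by simp [coordTorus])
  · change _ ∈ (prodEmbedding n r).range
    convert mul_mem_range_prodEmbedding (coordRep_mem (n := n) (G := SLr r)
      (Sum.inr (some (j, k)))) (coordTorus_mem (Sum.inr true)) using 1
    funext p
    exact (coordGL_scalar_mul _ _ _ _).trans (mul_comm _ _)

theorem descended_le_fixedFunctions : descended n r ≤
    fixedFunctions fun (ζ : Mu2 r) p => (scaleRep ζ p.1, scaleTorus ζ p.2) := by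
  rintro _ ⟨f, -, rfl⟩
  exact mem_fixedFunctions.2 fun ζ p => congrArg f (unscale_scale ζ p)

/-- The function `(p, (z₁, z₂)) ↦ z₁ ^ i z₂ ^ j`. -/
def torusMonomial (n r i j : ℕ) : Rep n (SLr r) × (ℂˣ × ℂˣ) → ℂ :=
  fun p => (p.2.1 : ℂ) ^ i * (p.2.2 : ℂ) ^ j

theorem torusMonomial_mul (i j i' j' : ℕ) :
    torusMonomial n r i j * torusMonomial n r i' j' = torusMonomial n r (i + i') (j + j') := by
  funext p
  simp only [torusMonomial, Pi.mul_apply]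
  ring

theorem torusMonomial_mem_descended {i j : ℕ} (hi : r ∣ i) (hj : r ∣ j) :
    torusMonomial n r i j ∈ descended n r := by
  obtain ⟨a, rfl⟩ := hi
  obtain ⟨b, rfl⟩ := hj
  refine ⟨coordRep n ⊤ (Sum.inl none) ^ a * coordRep n ⊤ (Sum.inr none) ^ b,
    mul_mem (pow_mem (coordRep_mem _) _) (pow_mem (coordRep_mem _) _), ?_⟩
  funext p
  refine (congrArg₂ (fun x y => x ^ a * y ^ b) (coordGL_scalar_mul_none _ _)
    (coordGL_scalar_mul_none _ _)).trans ?_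
  simp [torusMonomial, pow_mul]

theorem inv_pow_fst_mem_descended :
    (fun p => ((p.2.1⁻¹ : ℂˣ) : ℂ) ^ r) ∈ descended n r := by
  refine ⟨_, det_mem_RepRing Prod.fst fun j k => coordRep_mem (Sum.inl (some (j, k))), ?_⟩
  funext p
  change ((scalar (Fin r) p.2.1⁻¹ * p.1.1.1 : GL (Fin r) ℂ) : Matrix (Fin r) (Fin r) ℂ).det = _
  simp [det_SLr]

theorem inv_pow_snd_mem_descended :
    (fun p => ((p.2.2⁻¹ : ℂˣ) : ℂ) ^ r) ∈ descended n r := by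
  refine ⟨_, det_mem_RepRing Prod.snd fun j k => coordRep_mem (Sum.inr (some (j, k))), ?_⟩
  funext p
  change ((scalar (Fin r) p.2.2⁻¹ * p.1.1.2 : GL (Fin r) ℂ) : Matrix (Fin r) (Fin r) ℂ).det = _
  simp [det_SLr]

variable (n r) in
/-- The products of a monomial `z₁ ^ i z₂ ^ j` and a function that descends to `R_n(GL_r)`. -/
def monomialMultiples : Submonoid (Rep n (SLr r) × (ℂˣ × ℂˣ) → ℂ) where
  carrier := {f | ∃ i j, ∃ q ∈ descended n r, torusMonomial n r i j * q = f}
  one_mem' := ⟨0, 0, 1, one_mem _, by funext p; simp [torusMonomial]⟩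
  mul_mem' := by
    rintro _ _ ⟨i, j, q, hq, rfl⟩ ⟨i', j', q', hq', rfl⟩
    exact ⟨i + i', j + j', q * q', mul_mem hq hq', by rw [← torusMonomial_mul]; ring⟩

theorem range_prodEmbedding_le (hr : 1 ≤ r) :
    (prodEmbedding n r).range ≤ Algebra.adjoin ℂ (monomialMultiples n r : Set _) := by
  have hcoord : ∀ k, coordRep n ⊤ k ∘ unscale ∈ descended n r := fun k => ⟨_, coordRep_mem k, rfl⟩
  have hpow : ∀ z : ℂˣ, (z : ℂ) ^ (r - 1) * ((z⁻¹ : ℂˣ) : ℂ) ^ r = ((z⁻¹ : ℂˣ) : ℂ) := by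
    intro z
    obtain ⟨s, rfl⟩ := Nat.exists_eq_add_of_le' hr
    rw [Nat.add_sub_cancel, pow_succ, ← mul_assoc, ← mul_pow, Units.mul_inv, one_pow, one_mul]
  rw [prodEmbedding, externalProduct, Algebra.TensorProduct.productMap_range, AlgHom.range_comp,
    AlgHom.range_comp, Subalgebra.range_val, Subalgebra.range_val, RepRing, TorusRing,
    regularFunctions, regularFunctions, AlgHom.map_adjoin, AlgHom.map_adjoin]
  refine sup_le (Algebra.adjoin_mono ?_) (Algebra.adjoin_mono ?_)
  · rintro _ ⟨_, ⟨(_ | ⟨j, k⟩) | (_ | ⟨j, k⟩), rfl⟩, rfl⟩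
    · refine ⟨0, 0, 1, one_mem _, ?_⟩
      funext p
      simp [torusMonomial, coordRep, coordGL, det_SLr]
    · refine ⟨1, 0, _, hcoord (Sum.inl (some (j, k))), ?_⟩
      funext p
      change (p.2.1 : ℂ) ^ 1 * (p.2.2 : ℂ) ^ 0 *
        coordGL (scalar (Fin r) p.2.1⁻¹ * p.1.1.1.1) (some (j, k)) = coordGL p.1.1.1.1 (some (j, k))
      rw [coordGL_scalar_mul]
      simp
    · refine ⟨0, 0, 1, one_mem _, ?_⟩
      funext p
      simp [torusMonomial, coordRep, coordGL, det_SLr]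
    · refine ⟨0, 1, _, hcoord (Sum.inr (some (j, k))), ?_⟩
      funext p
      change (p.2.1 : ℂ) ^ 0 * (p.2.2 : ℂ) ^ 1 *
        coordGL (scalar (Fin r) p.2.2⁻¹ * p.1.1.2.1) (some (j, k)) = coordGL p.1.1.2.1 (some (j, k))
      rw [coordGL_scalar_mul]
      simp
  · rintro _ ⟨_, ⟨(_ | _) | (_ | _), rfl⟩, rfl⟩
    · exact ⟨1, 0, 1, one_mem _, by funext p; simp [torusMonomial, coordTorus]⟩
    · refine ⟨r - 1, 0, _, inv_pow_fst_mem_descended, ?_⟩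
      funext p
      simpa [torusMonomial, coordTorus] using hpow p.2.1
    · exact ⟨0, 1, 1, one_mem _, by funext p; simp [torusMonomial, coordTorus]⟩
    · refine ⟨0, r - 1, _, inv_pow_snd_mem_descended, ?_⟩
      funext p
      simpa [torusMonomial, coordTorus] using hpow p.2.2

/-! ### Averaging over `μ_r × μ_r` -/

/-- The character `(ζ₁, ζ₂) ↦ ζ₁ ^ i ζ₂ ^ j`. -/
def mu2Character (r i j : ℕ) : Mu2 r →* ℂ where
  toFun ζ := ((ζ.1 : ℂˣ) : ℂ) ^ i * ((ζ.2 : ℂˣ) : ℂ) ^ j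
  map_one' := by simp
  map_mul' ζ η := by
    simp only [Prod.fst_mul, Prod.snd_mul, Subgroup.coe_mul, Units.val_mul]
    ring

theorem dvd_of_mu2Character_eq_one (hr : 1 ≤ r) {i j : ℕ} (h : mu2Character r i j = 1) :
    r ∣ i ∧ r ∣ j := by
  have : NeZero r := ⟨by lia⟩
  have hζ := Complex.isPrimitiveRoot_exp r (NeZero.ne r)
  have h₁ := DFunLike.congr_fun h (hζ.toRootsOfUnity, 1)
  have h₂ := DFunLike.congr_fun h (1, hζ.toRootsOfUnity)
  simp only [mu2Character, MonoidHom.coe_mk, OneHom.coe_mk, OneMemClass.coe_one, Units.val_one,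
    one_pow, mul_one, one_mul, MonoidHom.one_apply, IsPrimitiveRoot.val_toRootsOfUnity_coe] at h₁ h₂
  exact ⟨hζ.dvd_of_pow_eq_one _ h₁, hζ.dvd_of_pow_eq_one _ h₂⟩

theorem sum_scale_mem_descended (hr : 1 ≤ r) [Fintype (Mu2 r)]
    {f : Rep n (SLr r) × (ℂˣ × ℂˣ) → ℂ} (hf : f ∈ (prodEmbedding n r).range) :
    ∑ ζ : Mu2 r, pullback (fun p : Rep n (SLr r) × (ℂˣ × ℂˣ) =>
      (scaleRep ζ p.1, scaleTorus ζ p.2)) f ∈ descended n r := by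
  have hspan : f ∈ Submodule.span ℂ (monomialMultiples n r : Set _) := by
    have h := range_prodEmbedding_le hr hf
    rwa [← Subalgebra.mem_toSubmodule, Algebra.adjoin_eq_span, Submonoid.closure_eq] at h
  clear hf
  induction hspan using Submodule.span_induction with
  | mem f h =>
    obtain ⟨i, j, q, hq, rfl⟩ := h
    have hterm : ∀ ζ : Mu2 r, pullback (fun p : Rep n (SLr r) × (ℂˣ × ℂˣ) =>
        (scaleRep ζ p.1, scaleTorus ζ p.2)) (torusMonomial n r i j * q) =
          mu2Character r i j ζ • (torusMonomial n r i j * q) := by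
      intro ζ
      funext p
      have := mem_fixedFunctions.1 (descended_le_fixedFunctions hq) ζ p
      simp only [pullback_apply, Pi.mul_apply, Pi.smul_apply, this]
      simp only [torusMonomial, scaleTorus, mu2Character, Units.val_mul, smul_eq_mul,
        MonoidHom.coe_mk, OneHom.coe_mk]
      ring
    rw [Finset.sum_congr rfl fun ζ _ => hterm ζ, ← Finset.sum_smul]
    classical
    by_cases h : mu2Character r i j = 1
    · obtain ⟨hi, hj⟩ := dvd_of_mu2Character_eq_one hr h
      exact Subalgebra.smul_mem _ (mul_mem (torusMonomial_mem_descended hi hj) hq) _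
    · rw [sum_hom_units_eq_zero _ h, zero_smul]
      exact zero_mem _
  | zero => simp
  | add f g _ _ hf hg =>
    simp only [map_add, Finset.sum_add_distrib]
    exact add_mem hf hg
  | smul c f _ hf =>
    simp only [map_smul, ← Finset.smul_sum]
    exact Subalgebra.smul_mem _ hf _

theorem range_inf_fixedFunctions (hr : 1 ≤ r) :
    (prodEmbedding n r).range ⊓
      fixedFunctions (fun (ζ : Mu2 r) p => (scaleRep ζ p.1, scaleTorus ζ p.2)) = descended n r := by
  refine le_antisymm ?_ (le_inf descended_le_range descended_le_fixedFunctions)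
  rintro f ⟨hf, hinv⟩
  have : NeZero r := ⟨by lia⟩
  let _ : Fintype (Mu2 r) := Fintype.ofFinite _
  have h := sum_scale_mem_descended hr hf
  rw [Finset.sum_congr rfl fun ζ _ => hinv ζ, Finset.sum_const, Finset.card_univ,
    ← Nat.cast_smul_eq_nsmul ℂ] at h
  have hc : (Fintype.card (Mu2 r) : ℂ) ≠ 0 := Nat.cast_ne_zero.2 Fintype.card_ne_zero
  simpa [smul_smul, hc] using Subalgebra.smul_mem _ h (Fintype.card (Mu2 r) : ℂ)⁻¹

/-! ### Invariants under conjugation -/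

variable (n r) in
/-- The functions on the product that are invariant under conjugation. -/
def conjInvariant : Subalgebra ℂ (Rep n (SLr r) × (ℂˣ × ℂˣ) → ℂ) :=
  fixedFunctions fun (g : SLr r) p => (conj g p.1, p.2)

theorem map_pullback_charRing (hr : 1 ≤ r) :
    (CharRing n (⊤ : Subgroup (GL (Fin r) ℂ))).map
      ((pullback unscale).comp (RepRing n (⊤ : Subgroup (GL (Fin r) ℂ))).val) =
      descended n r ⊓ conjInvariant n r := by
  ext f
  constructor
  · rintro ⟨q, hq, rfl⟩
    refine ⟨⟨q.1, q.2, rfl⟩, mem_fixedFunctions.2 fun g p => ?_⟩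
    exact (congrArg q.1 (unscale_conj g p.1 p.2)).trans (hq _ _)
  · rintro ⟨⟨q, hq, rfl⟩, hinv⟩
    refine ⟨⟨q, hq⟩, fun g p => ?_, rfl⟩
    obtain ⟨g', hg'⟩ := exists_conj_eq_conj_SLr (n := n) hr g
    obtain ⟨p, rfl⟩ := unscale_surjective hr p
    rw [hg', ← unscale_conj]
    exact mem_fixedFunctions.1 hinv g' p

variable (n r) in
/-- The functions on `R_n(SL_r)` that form the coordinate ring of the character variety. -/
def charInclusion : CharRing n (SLr r) →ₐ[ℂ] (Rep n (SLr r) → ℂ) :=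
  (RepRing n (SLr r)).val.comp (CharRing n (SLr r)).val

variable (n r) in
/-- The embedding of `ℂ[M_n(SL_r)] ⊗ ℂ[(ℂ*)²]` in the algebra of functions on the product of
`R_n(SL_r)` and the torus. -/
abbrev charEmbedding :
    CharRing n (SLr r) ⊗[ℂ] TorusRing →ₐ[ℂ] (Rep n (SLr r) × (ℂˣ × ℂˣ) → ℂ) :=
  externalProduct (S := CharRing n (SLr r)) (charInclusion n r) TorusRing.val

/-- The algebra of invariants of `μ_r × μ_r` in `S ⊗ ℂ[(ℂ*)²]`. -/
abbrev mu2Invariants (S : Type) [CommRing S] [Algebra ℂ S] (a : Mu2 r → S →ₐ[ℂ] S) :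
    Subalgebra ℂ (S ⊗[ℂ] TorusRing) :=
  invariants fun ζ : Mu2 r => Algebra.TensorProduct.map (a ζ) (torusAct ζ)

theorem charInclusion_injective : Function.Injective (charInclusion n r) :=
  Subtype.val_injective.comp Subtype.val_injective

theorem charInclusion_charAct (ζ : Mu2 r) (s : CharRing n (SLr r)) (p : Rep n (SLr r)) :
    charInclusion n r (charAct n ζ s) p = charInclusion n r s (scaleRep ζ p) := rfl

theorem torusAct_apply (ζ : Mu2 r) (q : TorusRing) (z : ℂˣ × ℂˣ) :
    TorusRing.val (torusAct ζ q) z = TorusRing.val q (scaleTorus ζ z) := rfl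

theorem range_externalProduct_charInclusion :
    (charEmbedding n r).range =
      (prodEmbedding n r).range ⊓ conjInvariant n r :=
  range_externalProduct_comp_val _ Subtype.val_injective fun _ => Iff.rfl

theorem map_charRing_invariants (hr : 1 ≤ r) :
    (mu2Invariants (CharRing n (SLr r)) fun ζ => charAct n ζ).map
      (charEmbedding n r) =
      descended n r ⊓ conjInvariant n r := by
  rw [map_externalProduct_invariants charInclusion_injective Subtype.val_injective
    charInclusion_charAct torusAct_apply, range_externalProduct_charInclusion, inf_right_comm,
    range_inf_fixedFunctions hr]

theorem map_repRing_invariants (hr : 1 ≤ r) :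
    (mu2Invariants (RepRing n (SLr r)) fun ζ => repAct n ζ).map
      (prodEmbedding n r) = descended n r := by
  rw [map_externalProduct_invariants (a := scaleRep) Subtype.val_injective Subtype.val_injective
    (fun _ _ _ => rfl) torusAct_apply, range_inf_fixedFunctions hr]

theorem pullback_unscale_injective (hr : 1 ≤ r) :
    Function.Injective (pullback (unscale (n := n) (r := r))) :=
  (unscale_surjective hr).injective_comp_right

theorem nonempty_repRing_algEquiv (hr : 1 ≤ r) :
    Nonempty (RepRing n (⊤ : Subgroup (GL (Fin r) ℂ)) ≃ₐ[ℂ]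
      (mu2Invariants (RepRing n (SLr r)) fun ζ => repAct n ζ)) :=
  nonempty_algEquiv_of_map_eq (pullback_unscale_injective hr)
    (externalProduct_injective Subtype.val_injective Subtype.val_injective)
    (map_repRing_invariants hr).symm

theorem nonempty_charRing_algEquiv (hr : 1 ≤ r) :
    Nonempty (CharRing n (⊤ : Subgroup (GL (Fin r) ℂ)) ≃ₐ[ℂ]
      (mu2Invariants (CharRing n (SLr r)) fun ζ => charAct n ζ)) :=
  nonempty_algEquiv_of_map_eq ((pullback_unscale_injective hr).comp Subtype.val_injective)
    (externalProduct_injective charInclusion_injective Subtype.val_injective)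
    ((map_pullback_charRing hr).trans (map_charRing_invariants hr).symm)

end TwistedHopf

end

theorem mainTheorem6 (n r : ℕ) (hn : 1 ≤ n) (hr : 1 ≤ r) :
    Nonempty (TwistedHopf.repVariety n (⊤ : Subgroup (GL (Fin r) ℂ)) ≅
      TwistedHopf.quotientByMu2 (TwistedHopf.RepRing n (TwistedHopf.SLr r))
        (fun ζ : TwistedHopf.Mu2 r => TwistedHopf.repAct n ζ)) ∧
    Nonempty (TwistedHopf.charVariety n (⊤ : Subgroup (GL (Fin r) ℂ)) ≅
      TwistedHopf.quotientByMu2 (TwistedHopf.CharRing n (TwistedHopf.SLr r))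
        (fun ζ : TwistedHopf.Mu2 r => TwistedHopf.charAct n ζ)) := by
  obtain ⟨e⟩ := TwistedHopf.nonempty_repRing_algEquiv (n := n) hr
  obtain ⟨e'⟩ := TwistedHopf.nonempty_charRing_algEquiv (n := n) hr
  exact ⟨TwistedHopf.nonempty_affineScheme_iso e, TwistedHopf.nonempty_affineScheme_iso e'⟩
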